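/- For a subset $C$ of a finite abelian group $H$ let $\Sigma(C)=\{\sum_{b\in B}b : B\subset C\}$, and call the stabiliser of a subset $X\subset H$ trivial if $g+X=X$ holds only for $g=0$. For $S\subset H$ and $c\in H$ write $S+c=\{s+c: s\in S\}$ and $\lambda_S(c)=|(S+c)\setminus S|$. (1) Let $H$ be a finite abelian group, $k\ge 0$ an integer, and let $C\subset H$ be such that $C$ generates $H$, $C\cap(-C)=\emptyset$, $\Sigma(C)$ has trivial stabiliser, and $|C|\ge 2^{2k+11}$. Let $S\subset H$ satisfy $\min(|S|,|H\setminus S|)\ge 2^{k+1}|C|$. Then there exists $c\in C$ with $$\lambda_S(c)\ \ge\ (1-2^{1-k})\,|C| .$$ (2) This is best possible up to the error term $2^{1-k}|C|$: for all integers $n\ge 1$ and $M\ge 0$ there exist an integer $N\ge1$ and sets $C,S\subset H=\mathbb{Z}/N\mathbb{Z}$ such that $C$ generates $H$, $C\cap(-C)=\emptyset$, $\Sigma(C)$ has trivial stabiliser, $|C|=n$, $\min(|S|,|H\setminus S|)\ge M$, and $\lambda_S(c)\le |C|$ for every $c\in C$. (In particular, taking $n\ge 2^{2k+11}$ and $M\ge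 2^{k+1}n$, all the hypotheses of (1) hold.) -/

import Mathlib

open scoped Pointwise

/-- `lam S c` is the number `λ_S(c) = |(S + c) \ S|` of elements of the translate `S + c`
that do not belong to `S`. -/
def lam {G : Type*} [AddCommGroup G] [DecidableEq G] (S : Finset G) (c : G) : ℕ :=
  ((c +ᵥ S) \ S).card

/-- The standing conditions on `C ⊆ H`: `C` generates `H`, `C ∩ (-C) = ∅`, and the set
`Σ(C)` of all sums of subsets of `C` has trivial stabiliser `{g : g + Σ(C) = Σ(C)} = {0}`. -/
def GoodGenerators {H : Type*} [AddCommGroup H] [DecidableEq H] (C : Finset H) : Prop :=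
  AddSubgroup.closure (C : Set H) = ⊤ ∧
  C ∩ (-C) = ∅ ∧
  AddAction.stabilizer H C.subsetSum = ⊥

/-! ### Translates of a finite set: symmetry and subadditivity of `lam`. -/

section Translate

variable {G : Type*} [AddCommGroup G] [DecidableEq G]

/-! `lam S` is symmetric and subadditive, so if it is at most m on A = C ∪ -C ∪ {0}, it is at most
pm on the p-fold sumset of A. If adding A enlarges every nonempty X with X + A ≠ H by at least κ,
there is a set T of size 2|S| on which `lam S` sums to roughly at most 2m|S|²/κ. Double counting
bounds that sum below by |S||T| - |S|² = |S|², so m is at least about κ/2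
(`mul_sq_card_le_of_forall_lam_le`). It remains to take κ close to 2|C|.

By Mann's theorem (`exists_addSubgroup_expansion_le`) it suffices to test κ on proper subgroups K:
adding A to K gains another coset or the elements of A outside K. The expansion can be small only if
a small subgroup contains much of C. This is excluded by |C ∩ K|² ≤ 64|K| (`card_filter_sq_le`): for
a minimal violating L, the subset sums of C ∩ L, grown greedily by a weak form of the same
isoperimetry, fill L. Then L stabilises Σ(C), so L = 0, which is absurd.

Sharpness comes from the intervals {1,…,n} and {0,…,M-1} in a long cycle. -/

theorem mem_vadd_finset_iff_neg_add_mem {S : Finset G} {c x : G} :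
    x ∈ c +ᵥ S ↔ -c + x ∈ S := by
  rw [← Finset.neg_vadd_mem_iff, vadd_eq_add]

theorem lam_add_card_inter (S : Finset G) (c : G) : lam S c + ((c +ᵥ S) ∩ S).card = S.card := by
  rw [lam, Finset.card_sdiff_add_card_inter, Finset.card_vadd_finset]

theorem lam_zero (S : Finset G) : lam S 0 = 0 := by simp [lam]

theorem lam_neg (S : Finset G) (c : G) : lam S (-c) = lam S c := by
  have h1 := lam_add_card_inter S c
  have h2 := lam_add_card_inter S (-c)
  have h3 : ((-c +ᵥ S) ∩ S).card = ((c +ᵥ S) ∩ S).card := by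
    rw [← Finset.card_vadd_finset c ((-c +ᵥ S) ∩ S), Finset.vadd_finset_inter, vadd_vadd,
      add_neg_cancel, zero_vadd, Finset.inter_comm]
  omega

theorem lam_add_le (S : Finset G) (a b : G) : lam S (a + b) ≤ lam S a + lam S b := by
  have h : ((a + b) +ᵥ S) \ S ⊆ ((a +ᵥ S) \ S) ∪ (a +ᵥ ((b +ᵥ S) \ S)) := by
    rw [Finset.vadd_finset_sdiff, vadd_vadd]
    intro x hx
    simp only [Finset.mem_union, Finset.mem_sdiff] at hx ⊢
    tauto
  calc lam S (a + b) ≤ _ := Finset.card_le_card h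
    _ ≤ _ := Finset.card_union_le _ _
    _ = _ := by rw [Finset.card_vadd_finset]; rfl

theorem lam_compl [Fintype G] (S : Finset G) (c : G) : lam Sᶜ c = lam S c := by
  have h : (c +ᵥ Sᶜ) \ Sᶜ = S \ (c +ᵥ S) := by
    ext x
    simp only [Finset.mem_sdiff, Finset.mem_compl, mem_vadd_finset_iff_neg_add_mem]
    tauto
  have h2 := Finset.card_sdiff_add_card_inter S (c +ᵥ S)
  have h3 := lam_add_card_inter S c
  rw [Finset.inter_comm] at h2
  rw [lam, h]
  omega

/-- A pair (g, x) with x in (g + S) ∩ S is determined by the pair (x - g, x) in S × S. -/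
theorem card_mul_card_le_sum_lam (S T : Finset G) :
    S.card * T.card ≤ ∑ g ∈ T, lam S g + S.card * S.card := by
  have h1 : ∑ g ∈ T, lam S g + ∑ g ∈ T, ((g +ᵥ S) ∩ S).card = S.card * T.card := by
    rw [← Finset.sum_add_distrib, Finset.sum_congr rfl fun g _ => lam_add_card_inter S g]
    simp [mul_comm]
  have h2 : ∑ g ∈ T, ((g +ᵥ S) ∩ S).card ≤ S.card * S.card := by
    rw [← Finset.card_sigma, ← Finset.card_product]
    refine Finset.card_le_card_of_injOn (fun p => (-p.1 + p.2, p.2)) ?_ ?_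
    · rintro ⟨g, x⟩ hx
      simp only [Finset.coe_sigma, Set.mem_sigma_iff, Finset.mem_coe, Finset.mem_inter,
        mem_vadd_finset_iff_neg_add_mem] at hx
      simpa using hx.2
    · rintro ⟨g, x⟩ - ⟨g', x'⟩ - h
      simp only [Prod.mk.injEq] at h
      obtain ⟨h, rfl⟩ := h
      simpa using h
  omega

/-- The symmetric set `R ∪ -R ∪ {0}`. -/
def symmHull (R : Finset G) : Finset G := insert 0 (R ∪ -R)

theorem zero_mem_symmHull (R : Finset G) : 0 ∈ symmHull R := Finset.mem_insert_self _ _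

theorem lam_le_of_mem_symmHull {R S : Finset G} {m : ℕ} (hm : ∀ a ∈ R, lam S a ≤ m) :
    ∀ a ∈ symmHull R, lam S a ≤ m := by
  intro a ha
  simp only [symmHull, Finset.mem_insert, Finset.mem_union, Finset.mem_neg'] at ha
  obtain rfl | ha | ha := ha
  · simp [lam_zero]
  · exact hm a ha
  · rw [← lam_neg]; exact hm _ ha

theorem card_symmHull {R : Finset G} (hR : R ∩ -R = ∅) :
    (symmHull R).card = 2 * R.card + 1 := by
  have h0 : (0 : G) ∉ R ∪ -R := by
    intro h
    have h1 : (0 : G) ∈ R := by simpa using h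
    have : (0 : G) ∈ R ∩ -R := by simpa using h1
    simp [hR] at this
  rw [symmHull, Finset.card_insert_of_notMem h0, Finset.card_union_of_disjoint
    (Finset.disjoint_iff_inter_eq_empty.2 hR), Finset.card_neg, two_mul]

end Translate

/-! ### Expansion of sumsets and Mann's theorem. -/

section Connectivity

variable {G : Type*} [AddCommGroup G] [Fintype G] [DecidableEq G]

/-- Mann's theorem for symmetric sets: a proper subgroup realises the least expansion of a
set `X` with `X + A ≠ G`. -/
theorem exists_addSubgroup_expansion_le {A : Finset G} (h0 : (0 : G) ∈ A) (hneg : -A = A)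
    (hA : A ≠ Finset.univ) :
    ∃ (K : AddSubgroup G) (F : Finset G), (∀ x, x ∈ F ↔ x ∈ K) ∧ K ≠ ⊤ ∧
      ∀ X : Finset G, X.Nonempty → X + A ≠ Finset.univ →
        X.card + (F + A).card ≤ (X + A).card + F.card := by
  classical
  have hsub : ∀ X : Finset G, X ⊆ X + A := fun X => Finset.subset_add_left X h0
  have hcard : ∀ X : Finset G, X.card ≤ (X + A).card := fun X => Finset.card_le_card (hsub X)
  -- a set of least expansion
  obtain ⟨Y, hY, hYmin⟩ := Finset.exists_min_image
    (Finset.univ.filter fun X : Finset G => X.Nonempty ∧ X + A ≠ Finset.univ)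
    (fun X => (X + A).card - X.card) ⟨{0}, by simpa [Finset.singleton_add] using hA⟩
  obtain ⟨κ, hκ⟩ : ∃ κ, κ = (Y + A).card - Y.card := ⟨_, rfl⟩
  have hmin : ∀ X : Finset G, X.Nonempty → X + A ≠ Finset.univ → X.card + κ ≤ (X + A).card := by
    intro X h1 h2
    have := hYmin X (by simp [h1, h2])
    have := hcard X
    omega
  -- an atom
  obtain ⟨P, hP, hPmin⟩ := Finset.exists_min_image
    (Finset.univ.filter fun X : Finset G => X.Nonempty ∧ X + A ≠ Finset.univ ∧
      (X + A).card = X.card + κ)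
    (fun X => X.card) ⟨Y, by
      have := hcard Y
      simp only [Finset.mem_filter, Finset.mem_univ, true_and] at hY ⊢
      exact ⟨hY.1, hY.2, by omega⟩⟩
  simp only [Finset.mem_filter, Finset.mem_univ, true_and] at hP hPmin
  have htrans : ∀ (g : G) (X : Finset G), (g +ᵥ X) + A = g +ᵥ (X + A) := fun g X =>
    vadd_add_assoc g X A
  have hneuniv : ∀ X : Finset G, X ≠ Finset.univ ↔ X.card < Fintype.card G := fun X => by
    rw [Ne, ← Finset.card_eq_iff_eq_univ, lt_iff_le_and_ne]
    simp [Finset.card_le_univ]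
  -- As A = -A, the complement of P + A stays off P after adding A. Hence it too has least
  -- expansion, and is no smaller than the atom P.
  have hPc : P.card + P.card + κ ≤ Fintype.card G := by
    set Z := (P + A)ᶜ with hZ
    have hZne : Z.Nonempty := by
      rw [hZ, Finset.nonempty_iff_ne_empty, Ne, Finset.compl_eq_empty_iff]
      exact hP.2.1
    have hZA : Z + A ⊆ Pᶜ := by
      intro x hx
      obtain ⟨z, hz, a, ha, rfl⟩ := Finset.mem_add.1 hx
      rw [Finset.mem_compl]
      intro hp
      rw [hZ, Finset.mem_compl] at hz
      refine hz (Finset.mem_add.2 ⟨z + a, hp, -a, ?_, by abel⟩)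
      rw [← hneg]
      exact Finset.neg_mem_neg ha
    have h1 := Finset.card_le_card hZA
    have h2 := Finset.card_add_card_compl P
    have h3 := Finset.card_add_card_compl (P + A)
    rw [← hZ] at h3
    have h4 := hP.1.card_pos
    have h5 : Z + A ≠ Finset.univ := by rw [hneuniv]; omega
    have h6 := hmin Z hZne h5
    have h7 := hPmin Z ⟨hZne, h5, by omega⟩
    omega
  -- Submodularity of |X + A|: P ∩ Q again has least expansion, so it equals P by minimality. `hPc`
  -- is what keeps P ∪ Q + A proper.
  have hinter : ∀ g : G, (P ∩ (g +ᵥ P)).Nonempty → g +ᵥ P = P := by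
    intro g hne
    set Q := g +ᵥ P with hQ
    have hQc : Q.card = P.card := Finset.card_vadd_finset g P
    have hQA : (Q + A).card = P.card + κ := by
      rw [hQ, htrans, Finset.card_vadd_finset, hP.2.2]
    have hI : P ∩ Q + A ≠ Finset.univ := by
      rw [hneuniv]
      have := Finset.card_le_card
        (Finset.add_subset_add_right (t := A) (Finset.inter_subset_left (s₁ := P) (s₂ := Q)))
      have := (hneuniv _).1 hP.2.1
      omega
    have hIk := hmin _ hne hI
    have hsm : ((P ∪ Q) + A).card + ((P ∩ Q) + A).card ≤ (P + A).card + (Q + A).card := by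
      rw [← Finset.card_union_add_card_inter (P + A), ← Finset.union_add]
      gcongr
      exact Finset.inter_add_subset
    have hcu := Finset.card_union_add_card_inter P Q
    have hpos := hne.card_pos
    have hU : P ∪ Q + A ≠ Finset.univ := by rw [hneuniv]; omega
    have hUk := hmin _ (hP.1.mono Finset.subset_union_left) hU
    have hle := hPmin (P ∩ Q) ⟨hne, hI, by omega⟩
    have e1 : P ∩ Q = P := Finset.eq_of_subset_of_card_le Finset.inter_subset_left hle
    have e2 : P ∩ Q = Q := Finset.eq_of_subset_of_card_le Finset.inter_subset_right (by omega)
    rw [← e2, e1]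
  obtain ⟨p, hp⟩ := hP.1
  set F := -p +ᵥ P with hF
  have hFx : ∀ x ∈ F, x +ᵥ F = F := by
    intro x hx
    rw [hF, mem_vadd_finset_iff_neg_add_mem, neg_neg] at hx
    have : x +ᵥ P = P := hinter x ⟨p + x, by
      rw [Finset.mem_inter, mem_vadd_finset_iff_neg_add_mem]
      exact ⟨hx, by simpa [add_comm] using hp⟩⟩
    rw [hF, vadd_vadd, add_comm, ← vadd_vadd, this]
  have hF0 : (0 : G) ∈ F := by
    rw [hF, mem_vadd_finset_iff_neg_add_mem]; simpa using hp
  have hFcard : F.card = P.card := Finset.card_vadd_finset _ _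
  have hFA : (F + A).card = P.card + κ := by
    rw [hF, htrans, Finset.card_vadd_finset, hP.2.2]
  let K : AddSubgroup G :=
    { carrier := F
      zero_mem' := hF0
      add_mem' := by
        intro a b ha hb
        rw [← hFx a ha]
        exact Finset.coe_vadd_finset a F ▸ Set.vadd_mem_vadd_set hb
      neg_mem' := by
        intro a ha
        have h := hF0
        rw [← hFx a ha, mem_vadd_finset_iff_neg_add_mem] at h
        simpa using h }
  refine ⟨K, F, fun x => Iff.rfl, fun htop => ?_, fun X hX hXA => ?_⟩
  · have : F = Finset.univ := by
      ext x
      have : x ∈ K := htop ▸ AddSubgroup.mem_top x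
      exact iff_of_true this (Finset.mem_univ x)
    have h1 : F.card = Fintype.card G := by rw [this, Finset.card_univ]
    have := (hneuniv _).1 hP.2.1
    omega
  · have := hmin X hX hXA
    omega

/-- Only the subgroup from Mann's theorem needs testing. Since R generates G, some r in R lies
outside it and yields a second coset; alternatively E lies in the sumset and off the subgroup. -/
theorem card_add_le_card_add_symmHull {R : Finset G} {κ : ℕ}
    (hR : AddSubgroup.closure (R : Set G) = ⊤)
    (hκ : ∀ K : AddSubgroup G, K ≠ ⊤ → κ ≤ Nat.card K ∨
      ∃ E ⊆ symmHull R, κ ≤ E.card ∧ ∀ x ∈ E, x ∉ K)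
    {X : Finset G} (hX : X.Nonempty) (hXA : X + symmHull R ≠ Finset.univ) :
    X.card + κ ≤ (X + symmHull R).card := by
  classical
  set A := symmHull R with hA
  have h0 : (0 : G) ∈ A := by simp [hA, symmHull]
  have hneg : -A = A := by
    ext x
    simp [hA, symmHull, or_comm]
  by_cases hu : A = Finset.univ
  · refine absurd ?_ hXA
    obtain ⟨x, hx⟩ := hX
    ext y
    simp only [Finset.mem_univ, iff_true]
    exact Finset.mem_add.2 ⟨x, hx, y - x, by simp [hu], by abel⟩
  obtain ⟨K, F, hF, hK, hexp⟩ := exists_addSubgroup_expansion_le h0 hneg hu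
  have hFA : F ⊆ F + A := Finset.subset_add_left F h0
  have hFA' := Finset.card_le_card hFA
  suffices F.card + κ ≤ (F + A).card by
    have := hexp X hX hXA
    omega
  obtain h | ⟨E, hEA, hEκ, hEK⟩ := hκ K hK
  · have hNat : Nat.card K = F.card := by
      rw [Nat.card_eq_fintype_card, Fintype.card_of_subtype F hF]
    obtain ⟨r, hrR, hrK⟩ : ∃ r ∈ R, r ∉ K := by
      by_contra! h
      refine hK (top_le_iff.1 (hR ▸ ?_))
      rw [AddSubgroup.closure_le]
      exact fun x hx => h x hx
    have hd : Disjoint F (r +ᵥ F) := by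
      rw [Finset.disjoint_left]
      intro x hx hx'
      rw [mem_vadd_finset_iff_neg_add_mem, hF] at hx'
      rw [hF] at hx
      have := K.sub_mem hx hx'
      exact hrK (by simpa using this)
    have hs : F ∪ (r +ᵥ F) ⊆ F + A := by
      refine Finset.union_subset hFA fun x hx => ?_
      obtain ⟨y, hy, rfl⟩ := Finset.mem_vadd_finset.1 hx
      rw [vadd_eq_add, add_comm r y]
      exact Finset.add_mem_add hy (by simp [hA, symmHull, hrR])
    have := Finset.card_le_card hs
    rw [Finset.card_union_of_disjoint hd, Finset.card_vadd_finset] at this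
    omega
  · have hd : Disjoint F E := by
      rw [Finset.disjoint_left]
      intro x hx hx'
      exact hEK x hx' ((hF x).1 hx)
    have hs : F ∪ E ⊆ F + A := Finset.union_subset hFA
      (hEA.trans (Finset.subset_add_right A ((hF 0).2 K.zero_mem)))
    have := Finset.card_le_card hs
    rw [Finset.card_union_of_disjoint hd] at this
    omega

end Connectivity

/-! ### The isoperimetric inequality for `lam`. -/

section Core

variable {G : Type*} [AddCommGroup G] [Fintype G] [DecidableEq G]

/-- Adds one layer of ρ elements, each of cost at most (p + 1)m. Full layers have ρ = κ; a smaller ρ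
serves to end at a prescribed size. -/
theorem exists_card_eq_sum_lam_le_of_subset {A W T S : Finset G} {κ p ρ m : ℕ}
    (h0 : (0 : G) ∈ A)
    (hκ : ∀ X : Finset G, X.Nonempty → X + A ≠ Finset.univ → X.card + κ ≤ (X + A).card)
    (hm : ∀ a ∈ A, lam S a ≤ m) (hTW : T ⊆ W) (hW : ∀ w ∈ W, lam S w ≤ p * m)
    (hT : T.card = 1 + p * κ) (hsum : 2 * ∑ g ∈ T, lam S g ≤ m * (κ * (p * (p + 1))))
    (hρ : ρ ≤ κ) (hle : 1 + p * κ + ρ ≤ Fintype.card G) :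
    ∃ W' T' : Finset G, T' ⊆ W' ∧ (∀ w ∈ W', lam S w ≤ (p + 1) * m) ∧
      T'.card = 1 + p * κ + ρ ∧
      2 * ∑ g ∈ T', lam S g ≤ m * (κ * (p * (p + 1)) + 2 * ρ * (p + 1)) := by
  have hW' : ∀ w ∈ W + A, lam S w ≤ (p + 1) * m := by
    intro w hw
    obtain ⟨x, hx, a, ha, rfl⟩ := Finset.mem_add.1 hw
    have := lam_add_le S x a
    have := hW x hx
    have := hm a ha
    rw [add_mul, one_mul]
    omega
  have hTW' : T ⊆ W + A := hTW.trans (Finset.subset_add_left W h0)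
  have hcard : 1 + p * κ + ρ ≤ (W + A).card := by
    by_cases hu : W + A = Finset.univ
    · rwa [hu, Finset.card_univ]
    · have hTne : T.Nonempty := by rw [← Finset.card_pos]; omega
      have := hκ W (hTne.mono hTW) hu
      have := Finset.card_le_card hTW
      omega
  obtain ⟨T', hTT', hT'W, hT'⟩ :=
    Finset.exists_subsuperset_card_eq hTW' (n := 1 + p * κ + ρ) (by omega) hcard
  refine ⟨W + A, T', hT'W, hW', hT', ?_⟩
  have h1 : ∑ g ∈ T' \ T, lam S g ≤ ρ * ((p + 1) * m) := by
    refine (Finset.sum_le_card_nsmul _ _ ((p + 1) * m) fun g hg =>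
      hW' g (hT'W (Finset.mem_sdiff.1 hg).1)).trans ?_
    rw [smul_eq_mul, Finset.card_sdiff_of_subset hTT', hT', hT, Nat.add_sub_cancel_left]
  rw [← Finset.sum_sdiff hTT']
  nlinarith

theorem exists_card_eq_sum_lam_le {A S : Finset G} {κ m : ℕ} (h0 : (0 : G) ∈ A)
    (hκ : ∀ X : Finset G, X.Nonempty → X + A ≠ Finset.univ → X.card + κ ≤ (X + A).card)
    (hm : ∀ a ∈ A, lam S a ≤ m) (p : ℕ) (hle : 1 + p * κ ≤ Fintype.card G) :
    ∃ W T : Finset G, T ⊆ W ∧ (∀ w ∈ W, lam S w ≤ p * m) ∧ T.card = 1 + p * κ ∧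
      2 * ∑ g ∈ T, lam S g ≤ m * (κ * (p * (p + 1))) := by
  induction p with
  | zero => exact ⟨{0}, {0}, subset_rfl, by simp [lam_zero], by simp, by simp [lam_zero]⟩
  | succ p ih =>
    have hle' : 1 + p * κ + κ ≤ Fintype.card G := by rw [add_mul] at hle; omega
    obtain ⟨W, T, hTW, hW, hT, hsum⟩ := ih (by omega)
    obtain ⟨W', T', h1, h2, h3, h4⟩ :=
      exists_card_eq_sum_lam_le_of_subset h0 hκ hm hTW hW hT hsum le_rfl hle'
    exact ⟨W', T', h1, h2, by rw [h3]; ring, h4.trans (le_of_eq (by ring))⟩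

/-- An isoperimetric inequality: if adding `A` enlarges sets by at least `κ`, then some translate
by an element of `A` moves many elements out of `S`. -/
theorem mul_sq_card_le_of_forall_lam_le {A S : Finset G} {κ m : ℕ} (h0 : (0 : G) ∈ A)
    (hκ : ∀ X : Finset G, X.Nonempty → X + A ≠ Finset.univ → X.card + κ ≤ (X + A).card)
    (hκ0 : 0 < κ) (hm : ∀ a ∈ A, lam S a ≤ m) (hS : 0 < S.card)
    (hS2 : 2 * S.card ≤ Fintype.card G) :
    8 * κ * S.card ^ 2 ≤ m * (4 * S.card + κ) ^ 2 := by
  set s := S.card with hs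
  set p := (2 * s - 1) / κ with hp
  set ρ := (2 * s - 1) % κ with hr
  have hdiv : κ * p + ρ = 2 * s - 1 := Nat.div_add_mod _ _
  have hρ : ρ < κ := Nat.mod_lt _ hκ0
  -- The size t = 2s maximises s/t - s²/t², hence the resulting lower bound on m.
  have hcard : 1 + p * κ + ρ = 2 * s := by rw [mul_comm p]; omega
  obtain ⟨W, T, hTW, hW, hT, hsum⟩ := exists_card_eq_sum_lam_le h0 hκ hm p (by omega)
  obtain ⟨W', T', -, -, h3, h4⟩ :=
    exists_card_eq_sum_lam_le_of_subset h0 hκ hm hTW hW hT hsum hρ.le (by omega)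
  have h5 := card_mul_card_le_sum_lam S T'
  rw [h3, hcard, ← hs] at h5
  have h6 : 2 * s ^ 2 ≤ m * (κ * (p * (p + 1)) + 2 * ρ * (p + 1)) := by nlinarith
  -- The slack is at least (2ρ - κ)².
  have h7 : 4 * κ * (κ * (p * (p + 1)) + 2 * ρ * (p + 1)) ≤ (4 * s + κ) ^ 2 := by
    have h8 : 4 * s = 2 * (1 + p * κ + ρ) := by omega
    rw [h8]
    zify
    nlinarith [sq_nonneg (2 * (ρ : ℤ) - κ), Nat.zero_le (p * κ), Nat.zero_le ρ]
  calc 8 * κ * s ^ 2 = 4 * κ * (2 * s ^ 2) := by ring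
    _ ≤ 4 * κ * (m * (κ * (p * (p + 1)) + 2 * ρ * (p + 1))) := Nat.mul_le_mul_left _ h6
    _ = m * (4 * κ * (κ * (p * (p + 1)) + 2 * ρ * (p + 1))) := by ring
    _ ≤ _ := Nat.mul_le_mul_left _ h7

/-- A crude bound free of stabiliser assumptions. For |S| ≤ |R|/2, averaging over R suffices.
Otherwise κ = |R| is admissible: a subgroup with fewer than |R| elements misses more than |R| of the
2|R| + 1 elements of `symmHull R`. -/
theorem exists_lam_ge {R S : Finset G} (hR : AddSubgroup.closure (R : Set G) = ⊤)
    (hRR : R ∩ -R = ∅) (hRne : R.Nonempty) (hS : 0 < S.card)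
    (hS2 : 2 * S.card ≤ Fintype.card G) :
    ∃ x ∈ R, S.card ≤ 2 * lam S x ∨ 2 * R.card ≤ 9 * lam S x := by
  classical
  obtain ⟨x, hx, hmax⟩ := Finset.exists_max_image R (lam S) hRne
  refine ⟨x, hx, ?_⟩
  by_contra! hcon
  obtain ⟨h1, h2⟩ := hcon
  have hRpos := hRne.card_pos
  by_cases hsr : 2 * S.card ≤ R.card
  · have h3 := card_mul_card_le_sum_lam S R
    have h4 : ∑ g ∈ R, lam S g ≤ R.card * lam S x := by
      simpa using Finset.sum_le_card_nsmul R (lam S) _ hmax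
    nlinarith
  · have hκ : ∀ K : AddSubgroup G, K ≠ ⊤ → R.card ≤ Nat.card K ∨
        ∃ E ⊆ symmHull R, R.card ≤ E.card ∧ ∀ x ∈ E, x ∉ K := by
      intro K _
      by_cases hK : R.card ≤ Nat.card K
      · exact Or.inl hK
      refine Or.inr ⟨(symmHull R).filter (· ∉ K), Finset.filter_subset _ _, ?_, by simp⟩
      have h3 := Finset.card_filter_add_card_filter_not (s := symmHull R) (· ∈ K)
      have h4 : ((symmHull R).filter (· ∈ K)).card ≤ Nat.card K := by
        rw [← SetLike.coe_sort_coe, Nat.card_coe_set_eq, ← Set.ncard_coe_finset]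
        exact Set.ncard_le_ncard (by intro x; simp) (Set.toFinite _)
      have := card_symmHull hRR
      omega
    have h3 := mul_sq_card_le_of_forall_lam_le (zero_mem_symmHull R)
      (fun X hX hXA => card_add_le_card_add_symmHull hR hκ hX hXA) hRpos
      (lam_le_of_mem_symmHull hmax) hS hS2
    have h4 : (4 * S.card + R.card) ^ 2 ≤ (6 * S.card) ^ 2 :=
      Nat.pow_le_pow_left (by omega) 2
    have h5 := h3.trans (Nat.mul_le_mul_left _ h4)
    have h6 : 0 < S.card ^ 2 := by positivity
    have h7 : 8 * R.card * S.card ^ 2 ≤ 36 * lam S x * S.card ^ 2 := by nlinarith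
    have := Nat.le_of_mul_le_mul_right h7 h6
    omega

end Core

/-! ### Growth of subset sums. -/

section SubsetSum

variable {G : Type*} [AddCommGroup G] [DecidableEq G]

theorem card_subsetSum_add_lam_le {V : Finset G} {x : G} (hx : x ∉ V) :
    V.subsetSum.card + lam V.subsetSum x ≤ (insert x V).subsetSum.card := by
  rw [lam, ← Finset.card_union_of_disjoint Finset.disjoint_sdiff]
  refine Finset.card_le_card (Finset.union_subset
    (Finset.subsetSum_mono (Finset.subset_insert x V)) ?_)
  exact Finset.sdiff_subset.trans (Finset.vadd_finset_subsetSum_subset_subsetSum_insert hx)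

theorem subsetSum_union {V W : Finset G} (h : Disjoint V W) :
    (V ∪ W).subsetSum = V.subsetSum + W.subsetSum := by
  ext x
  simp only [Finset.mem_add, Finset.mem_subsetSum_iff]
  constructor
  · rintro ⟨B, hB, rfl⟩
    refine ⟨_, ⟨B ∩ V, Finset.inter_subset_right, rfl⟩, _,
      ⟨B \ V, fun b hb => ?_, rfl⟩, Finset.sum_inter_add_sum_sdiff B V _⟩
    rw [Finset.mem_sdiff] at hb
    exact (Finset.mem_union.1 (hB hb.1)).resolve_left hb.2
  · rintro ⟨_, ⟨B, hB, rfl⟩, _, ⟨D, hD, rfl⟩, rfl⟩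
    exact ⟨B ∪ D, Finset.union_subset_union hB hD,
      Finset.sum_union (Finset.disjoint_of_subset_left hB (Finset.disjoint_of_subset_right hD h))⟩

theorem add_eq_univ_of_card_lt [Fintype G] {A B : Finset G}
    (h : Fintype.card G < A.card + B.card) : A + B = Finset.univ := by
  ext x
  simp only [Finset.mem_univ, iff_true]
  have hc : (A ∩ (x +ᵥ -B)).Nonempty := by
    rw [Finset.nonempty_iff_ne_empty, Ne, ← Finset.disjoint_iff_inter_eq_empty]
    intro hd
    have h1 := Finset.card_le_univ (A ∪ (x +ᵥ -B))
    rw [Finset.card_union_of_disjoint hd, Finset.card_vadd_finset, Finset.card_neg] at h1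
    omega
  obtain ⟨a, ha⟩ := hc
  rw [Finset.mem_inter, mem_vadd_finset_iff_neg_add_mem, Finset.mem_neg'] at ha
  exact Finset.mem_add.2 ⟨a, ha.1, _, ha.2, by abel⟩

theorem inter_neg_eq_empty_of_subset {R E : Finset G} (h : R ⊆ E) (hE : E ∩ -E = ∅) :
    R ∩ -R = ∅ := by
  rw [← Finset.subset_empty, ← hE]
  exact Finset.inter_subset_inter h (Finset.neg_subset_neg h)

theorem two_mul_card_lt_card [Fintype G] {E : Finset G} (hE : E ∩ -E = ∅) :
    2 * E.card < Fintype.card G := by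
  have := card_symmHull hE
  have := Finset.card_le_univ (symmHull E)
  omega

/-- Greedy growth by `exists_lam_ge` applied to the unused elements; U and V take at most a seventh
of E each, leaving 5/7. The values 1, 2, 3, 5, 8, 12 iterate s ↦ s + ⌈s/2⌉; from i = 5 on, s/2 ≥ i +
1 and growth is quadratic. -/
theorem exists_subset_card_subsetSum_ge [Fintype G] {E U : Finset G}
    (hgen : ∀ R ⊆ E, 5 * E.card ≤ 7 * R.card → AddSubgroup.closure (R : Set G) = ⊤)
    (hEE : E ∩ -E = ∅) (hE : 129 ≤ E.card) (hUE : U ⊆ E) (hU : 7 * U.card ≤ E.card)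
    (i : ℕ) (hi : 7 * i ≤ E.card) :
    ∃ V ⊆ E \ U, V.card = i ∧ (Fintype.card G < 2 * V.subsetSum.card ∨
      1 ≤ V.subsetSum.card ∧ (1 ≤ i → 2 ≤ V.subsetSum.card) ∧ (2 ≤ i → 3 ≤ V.subsetSum.card) ∧
      (3 ≤ i → 5 ≤ V.subsetSum.card) ∧ (4 ≤ i → 8 ≤ V.subsetSum.card) ∧
      (5 ≤ i → 12 ≤ V.subsetSum.card) ∧ i * (i + 1) ≤ 2 * V.subsetSum.card + 6) := by
  induction i with
  | zero =>
    refine ⟨∅, Finset.empty_subset _, rfl, Or.inr ⟨?_, ?_⟩⟩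
    · exact Finset.card_pos.2 ⟨0, Finset.zero_mem_subsetSum⟩
    · omega
  | succ i ih =>
    obtain ⟨V, hV, hVi, hVs⟩ := ih (by omega)
    set R := (E \ U) \ V with hR
    have hRE : R ⊆ E := Finset.sdiff_subset.trans Finset.sdiff_subset
    have hRc : R.card + i + U.card = E.card := by
      have h1 := Finset.card_sdiff_add_card_eq_card hV
      have h2 := Finset.card_sdiff_add_card_eq_card hUE
      rw [← hR] at h1
      omega
    have hRne : R.Nonempty := by rw [← Finset.card_pos]; omega
    have hstep : ∀ x ∈ R, insert x V ⊆ E \ U ∧ (insert x V).card = i + 1 ∧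
        V.subsetSum.card + lam V.subsetSum x ≤ (insert x V).subsetSum.card := by
      intro x hx
      rw [hR, Finset.mem_sdiff] at hx
      exact ⟨Finset.insert_subset hx.1 hV, by rw [Finset.card_insert_of_notMem hx.2, hVi],
        card_subsetSum_add_lam_le hx.2⟩
    by_cases hbig : Fintype.card G < 2 * V.subsetSum.card
    · obtain ⟨x, hx⟩ := hRne
      obtain ⟨h1, h2, h3⟩ := hstep x hx
      exact ⟨_, h1, h2, Or.inl (by omega)⟩
    obtain ⟨hs1, hs2, hs3, hs4, hs5, hs6, hs7⟩ := hVs.resolve_left hbig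
    obtain ⟨x, hx, hlam⟩ := exists_lam_ge (hgen R hRE (by omega))
      (inter_neg_eq_empty_of_subset hRE hEE) hRne hs1 (not_lt.1 hbig)
    obtain ⟨h1, h2, h3⟩ := hstep x hx
    refine ⟨_, h1, h2, Or.inr ?_⟩
    -- Here 2|R|/9 ≥ 10|E|/63 ≥ |E|/7 ≥ i + 1, and |E| ≥ 129 makes it at least 18.
    have h4 : V.subsetSum.card ≤ 2 * lam V.subsetSum x ∨
        (i + 1 ≤ lam V.subsetSum x ∧ 18 ≤ lam V.subsetSum x) := by omega
    have h5 : (i + 1) * (i + 1 + 1) = i * (i + 1) + 2 * (i + 1) := by ring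
    refine ⟨by omega, by omega, by omega, by omega, by omega, by omega, ?_⟩
    obtain h4 | h4 := h4
    · by_cases hi5 : 5 ≤ i
      · have : 4 * (i + 1) ≤ i * (i + 1) := Nat.mul_le_mul_right _ (by omega)
        have : 5 * i ≤ i * i := Nat.mul_le_mul_right _ hi5
        have : i * (i + 1) = i * i + i := by ring
        omega
      · interval_cases i <;> omega
    · omega

theorem subsetSum_eq_univ [Fintype G] {E : Finset G}
    (hgen : ∀ R ⊆ E, 5 * E.card ≤ 7 * R.card → AddSubgroup.closure (R : Set G) = ⊤)
    (hEE : E ∩ -E = ∅) (hE : 64 * Fintype.card G < E.card ^ 2) :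
    E.subsetSum = Finset.univ := by
  have hE2 := two_mul_card_lt_card hEE
  have h129 : 129 ≤ E.card := by nlinarith
  set N := E.card / 7 with hN
  have hfin : ∀ U ⊆ E, 7 * U.card ≤ E.card →
      ∃ V ⊆ E \ U, V.card = N ∧ Fintype.card G < 2 * V.subsetSum.card := by
    intro U hUE hU
    obtain ⟨V, hV, hVN, h⟩ :=
      exists_subset_card_subsetSum_ge hgen hEE h129 hUE hU N (by omega)
    refine ⟨V, hV, hVN, ?_⟩
    obtain h | ⟨-, -, -, -, -, -, h⟩ := h
    · exact h
    · have h1 : E.card ^ 2 ≤ (7 * N + 6) ^ 2 := Nat.pow_le_pow_left (by omega) 2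
      have h2 : 18 ≤ N := by omega
      nlinarith
  obtain ⟨V, hV, hVN, hVs⟩ := hfin ∅ (Finset.empty_subset _) (by simp)
  rw [Finset.sdiff_empty] at hV
  -- Two disjoint parts of E, each with more than |G|/2 subset sums, together reach all of G.
  obtain ⟨W, hW, -, hWs⟩ := hfin V hV (by omega)
  have hd : Disjoint V W := Finset.disjoint_of_subset_right hW Finset.disjoint_sdiff
  rw [← Finset.univ_subset_iff, ← add_eq_univ_of_card_lt (A := V.subsetSum) (B := W.subsetSum)
    (by omega), ← subsetSum_union hd]
  exact Finset.subsetSum_mono (Finset.union_subset hV (hW.trans Finset.sdiff_subset))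

end SubsetSum

/-! ### Few elements of C in any subgroup. -/

section Subgroup

open Classical in
-- A proper subgroup has index at least 2, while (5/7)² > 1/2, so a proper closure would violate
-- `hmin`.
theorem closure_eq_top_of_forall_lt {G : Type*} [AddCommGroup G] [Fintype G] {L : AddSubgroup G} {E : Finset L}
    (hmin : ∀ K < L, ∀ R : Finset L, R ⊆ E → (∀ x ∈ R, (x : G) ∈ K) →
      R.card ^ 2 ≤ 64 * Nat.card K)
    (hE : 64 * Nat.card L < E.card ^ 2) {R : Finset L} (hRE : R ⊆ E)
    (hR : 5 * E.card ≤ 7 * R.card) : AddSubgroup.closure (R : Set L) = ⊤ := by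
  by_contra hne
  set K := (AddSubgroup.closure (R : Set L)).map L.subtype with hK
  have hKL : K ≤ L := by
    rw [hK]
    exact AddSubgroup.map_subtype_le _
  have hcard : Nat.card K = Nat.card (AddSubgroup.closure (R : Set L)) :=
    AddSubgroup.card_map_of_injective L.subtype_injective
  have hdvd : Nat.card K ∣ Nat.card L := AddSubgroup.card_dvd_of_le hKL
  have hlt : K ≠ L := by
    intro h
    exact hne (AddSubgroup.eq_top_of_card_eq _ (by rw [← hcard, h]))
  have hne' : Nat.card K ≠ Nat.card L := by
    intro h
    exact hne (AddSubgroup.eq_top_of_card_eq _ (by rw [← hcard, h]))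
  have h1 := hmin K (lt_of_le_of_ne hKL hlt) R hRE fun x hx =>
    ⟨x, AddSubgroup.subset_closure hx, rfl⟩
  obtain ⟨q, hq⟩ := hdvd
  have hLpos : 0 < Nat.card L := Nat.card_pos
  have h2 : 2 * Nat.card K ≤ Nat.card L := by
    rw [hq, mul_comm]
    refine Nat.mul_le_mul_left _ ?_
    by_contra! hq2
    interval_cases q <;> omega
  have h3 : (5 * E.card) ^ 2 ≤ (7 * R.card) ^ 2 := Nat.pow_le_pow_left hR 2
  nlinarith

variable {G : Type*} [AddCommGroup G] [Fintype G] [DecidableEq G]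

open Classical in
/-- If the set of subset sums of `C` has trivial stabiliser, then no subgroup contains too many
elements of `C`. -/
theorem card_filter_sq_le {C : Finset G} (hCC : C ∩ -C = ∅)
    (hC : AddAction.stabilizer G C.subsetSum = ⊥) (K : AddSubgroup G) :
    (C.filter (· ∈ K)).card ^ 2 ≤ 64 * Nat.card K := by
  by_contra! hcon
  obtain ⟨L, hL, hLmin⟩ := exists_minimal_of_wellFoundedLT
    (fun L : AddSubgroup G => 64 * Nat.card L < (C.filter (· ∈ L)).card ^ 2) ⟨K, hcon⟩
  set E : Finset L := C.subtype (· ∈ L) with hEdef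
  have hEmap : E.map (Function.Embedding.subtype _) = C.filter (· ∈ L) :=
    Finset.subtype_map _
  have hEcard : E.card = (C.filter (· ∈ L)).card := by rw [← hEmap, Finset.card_map]
  have hEE : E ∩ -E = ∅ := by
    rw [Finset.eq_empty_iff_forall_notMem]
    intro x hx
    rw [Finset.mem_inter, Finset.mem_neg', hEdef, Finset.mem_subtype, Finset.mem_subtype] at hx
    have : (x : G) ∈ C ∩ -C := by
      rw [Finset.mem_inter, Finset.mem_neg']
      exact hx
    simp [hCC] at this
  have hE : 64 * Nat.card L < E.card ^ 2 := by rw [hEcard]; exact hL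
  have huniv : E.subsetSum = Finset.univ := by
    refine subsetSum_eq_univ (fun R hRE hR => ?_) hEE (by rwa [← Nat.card_eq_fintype_card])
    refine closure_eq_top_of_forall_lt (fun K' hK' R' hR'E hR' => ?_) hE hRE hR
    have h1 : R'.card ≤ (C.filter (· ∈ K')).card := by
      rw [← Finset.card_map (Function.Embedding.subtype _)]
      refine Finset.card_le_card fun y hy => ?_
      obtain ⟨x, hx, rfl⟩ := Finset.mem_map.1 hy
      exact Finset.mem_filter.2 ⟨Finset.mem_subtype.1 (hR'E hx), hR' x hx⟩
    by_contra! h2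
    exact hK'.not_ge (hLmin (h2.trans_le (Nat.pow_le_pow_left h1 2)) hK'.le)
  have hLsub : ∀ g ∈ L, g ∈ (C.filter (· ∈ L)).subsetSum := by
    intro g hg
    have : (⟨g, hg⟩ : L) ∈ E.subsetSum := huniv ▸ Finset.mem_univ _
    obtain ⟨B, hB, hBs⟩ := Finset.mem_subsetSum_iff.1 this
    refine Finset.mem_subsetSum_iff.2 ⟨B.map (Function.Embedding.subtype _), ?_, ?_⟩
    · rw [← hEmap]
      exact Finset.map_subset_map.2 hB
    · rw [Finset.sum_map]
      simpa using congrArg (L.subtype) hBs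
  have hsubL : ∀ g ∈ (C.filter (· ∈ L)).subsetSum, g ∈ L := by
    intro g hg
    obtain ⟨B, hB, rfl⟩ := Finset.mem_subsetSum_iff.1 hg
    exact L.sum_mem fun b hb => (Finset.mem_filter.1 (hB hb)).2
  have hstab : ∀ g ∈ L, g ∈ AddAction.stabilizer G C.subsetSum := by
    intro g hg
    rw [AddAction.mem_stabilizer_iff]
    have hun : C.filter (· ∈ L) ∪ C.filter (· ∉ L) = C := Finset.filter_union_filter_not_eq _ _
    have hd : Disjoint (C.filter (· ∈ L)) (C.filter (· ∉ L)) :=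
      Finset.disjoint_filter_filter_not _ _ _
    rw [← hun, subsetSum_union hd, ← vadd_add_assoc]
    congr 1
    ext x
    rw [mem_vadd_finset_iff_neg_add_mem]
    constructor
    · intro hx
      have := L.add_mem hg (hsubL _ hx)
      exact hLsub x (by simpa using this)
    · intro hx
      exact hLsub _ (L.add_mem (L.neg_mem hg) (hsubL x hx))
  have hLbot : L = ⊥ := by
    rw [eq_bot_iff, ← hC]
    exact hstab
  have hempty : C.filter (· ∈ L) = ∅ := by
    rw [Finset.filter_eq_empty_iff]
    intro x hx hxL
    rw [hLbot, AddSubgroup.mem_bot] at hxL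
    subst hxL
    have : (0 : G) ∈ C ∩ -C := by simpa using hx
    simp [hCC] at this
  rw [hempty] at hL
  simp at hL

end Subgroup

/-! ### The lower bound (1). -/

section LowerBound

variable {G : Type*} [AddCommGroup G] [Fintype G] [DecidableEq G]

open Classical in
-- If |K| < 2|C|, then |C ∩ K|² ≤ 128|C| ≤ (|C|/Q)², so C ∪ -C loses at most 2|C|/Q elements to K.
theorem le_card_or_exists_subset_symmHull {C : Finset G} (hCC : C ∩ -C = ∅)
    (hC : AddAction.stabilizer G C.subsetSum = ⊥) {Q : ℕ} (hQ : 0 < Q)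
    (hCQ : 128 * Q ^ 2 ≤ C.card) (K : AddSubgroup G) :
    2 * C.card - 2 * C.card / Q ≤ Nat.card K ∨
      ∃ E ⊆ symmHull C, 2 * C.card - 2 * C.card / Q ≤ E.card ∧ ∀ x ∈ E, x ∉ K := by
  by_cases hK : 2 * C.card - 2 * C.card / Q ≤ Nat.card K
  · exact Or.inl hK
  set D := C.filter (· ∉ K) with hD
  have hDC : D ⊆ C := Finset.filter_subset _ _
  have hDD := inter_neg_eq_empty_of_subset hDC hCC
  refine Or.inr ⟨D ∪ -D, ?_, ?_, ?_⟩
  · exact (Finset.union_subset_union hDC (Finset.neg_subset_neg hDC)).trans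
      (Finset.subset_insert _ _)
  · rw [Finset.card_union_of_disjoint (Finset.disjoint_iff_inter_eq_empty.2 hDD), Finset.card_neg]
    have h1 := Finset.card_filter_add_card_filter_not (s := C) (· ∈ K)
    have h2 := card_filter_sq_le hCC hC K
    rw [← hD] at h1
    set c := (C.filter (· ∈ K)).card
    have h3 : Nat.card K ≤ 2 * C.card := (not_le.1 hK).le.trans (Nat.sub_le _ _)
    have h4 : (c * Q) ^ 2 ≤ C.card ^ 2 := by
      calc (c * Q) ^ 2 = c ^ 2 * Q ^ 2 := by ring
        _ ≤ (64 * (2 * C.card)) * Q ^ 2 :=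
          Nat.mul_le_mul_right _ (h2.trans (Nat.mul_le_mul_left _ h3))
        _ = (128 * Q ^ 2) * C.card := by ring
        _ ≤ C.card * C.card := Nat.mul_le_mul_right _ hCQ
        _ = C.card ^ 2 := by ring
    have h5 : c * Q ≤ C.card := (Nat.pow_le_pow_iff_left two_ne_zero).1 h4
    have h6 : 2 * c ≤ 2 * C.card / Q := by
      rw [Nat.le_div_iff_mul_le hQ]
      linarith
    omega
  · intro x hx hxK
    rw [Finset.mem_union, Finset.mem_neg', hD, Finset.mem_filter, Finset.mem_filter] at hx
    obtain hx | hx := hx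
    · exact hx.2 hxK
    · exact hx.2 (K.neg_mem hxK)

theorem sub_mul_card_le_of_forall_lam_le {C S : Finset G} (hC : GoodGenerators C) {Q m : ℕ}
    (hQ : 16 ≤ Q) (hCQ : 128 * Q ^ 2 ≤ C.card) (hS : Q * C.card ≤ 2 * S.card)
    (hS2 : 2 * S.card ≤ Fintype.card G) (hm : ∀ c ∈ C, lam S c ≤ m) :
    (Q - 8) * C.card ≤ Q * m := by
  obtain ⟨hgen, hCC, hstab⟩ := hC
  set n := C.card with hn
  set s := S.card with hs
  set κ := 2 * n - 2 * n / Q with hκ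
  have hn0 : 0 < n := by
    have : 0 < Q ^ 2 := by positivity
    omega
  have hs0 : 0 < s := by
    have : 0 < Q * n := by positivity
    omega
  have hdiv : 2 * n / Q * Q ≤ 2 * n := Nat.div_mul_le_self _ _
  have hle : 2 * n / Q ≤ 2 * n := Nat.div_le_self _ _
  have hκQ : κ * Q + 2 * n ≥ 2 * n * Q := by
    rw [hκ, Nat.sub_mul]
    omega
  have hκn : κ ≤ 2 * n := Nat.sub_le _ _
  have hκ0 : 0 < κ := by
    by_contra! h
    have : κ = 0 := by omega
    rw [this] at hκQ
    nlinarith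
  have h1 := mul_sq_card_le_of_forall_lam_le (zero_mem_symmHull C)
    (fun X hX hXA => card_add_le_card_add_symmHull hgen
      (fun K _ => le_card_or_exists_subset_symmHull hCC hstab (by omega) hCQ K) hX hXA) hκ0
    (lam_le_of_mem_symmHull hm) hs0 hS2
  have h2 : Q * (4 * s + κ) ≤ 4 * s * (Q + 1) := by nlinarith
  have h3 : 8 * κ * Q ^ 2 * s ^ 2 ≤ 16 * m * (Q + 1) ^ 2 * s ^ 2 := by
    calc 8 * κ * Q ^ 2 * s ^ 2 = Q ^ 2 * (8 * κ * s ^ 2) := by ring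
      _ ≤ Q ^ 2 * (m * (4 * s + κ) ^ 2) := Nat.mul_le_mul_left _ h1
      _ = m * (Q * (4 * s + κ)) ^ 2 := by ring
      _ ≤ m * (4 * s * (Q + 1)) ^ 2 := by gcongr
      _ = _ := by ring
  have h4 : 8 * κ * Q ^ 2 ≤ 16 * m * (Q + 1) ^ 2 :=
    Nat.le_of_mul_le_mul_right h3 (by positivity)
  obtain ⟨q, rfl⟩ : ∃ q, Q = q + 8 := ⟨Q - 8, by omega⟩
  rw [Nat.add_sub_cancel]
  have h5 : n * (q + 7) * (q + 8) ≤ m * (q + 9) ^ 2 := by nlinarith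
  -- With Q = q + 8 this is (Q - 8)(Q + 1)² ≤ Q²(Q - 1).
  have h6 : q * (q + 9) ^ 2 ≤ (q + 8) ^ 2 * (q + 7) := by nlinarith
  have h7 : (q * n) * (q + 9) ^ 2 ≤ ((q + 8) * m) * (q + 9) ^ 2 := by
    calc (q * n) * (q + 9) ^ 2 = n * (q * (q + 9) ^ 2) := by ring
      _ ≤ n * ((q + 8) ^ 2 * (q + 7)) := Nat.mul_le_mul_left _ h6
      _ = (q + 8) * (n * (q + 7) * (q + 8)) := by ring
      _ ≤ (q + 8) * (m * (q + 9) ^ 2) := Nat.mul_le_mul_left _ h5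
      _ = _ := by ring
  exact Nat.le_of_mul_le_mul_right h7 (by positivity)

theorem exists_lam_ge_of_goodGenerators {C S : Finset G} {k : ℕ} (hC : GoodGenerators C)
    (hCk : 2 ^ (2 * k + 11) ≤ C.card)
    (hS : 2 ^ (k + 1) * C.card ≤ min S.card (Finset.univ \ S).card) :
    ∃ c ∈ C, (1 - (2 : ℝ) ^ (1 - (k : ℤ))) * (C.card : ℝ) ≤ (lam S c : ℝ) := by
  have hCne : C.Nonempty := by
    rw [← Finset.card_pos]
    exact lt_of_lt_of_le (by positivity) hCk
  -- For Q = 2^(k+2) the relative error 8/Q is 2^(1-k), and 128Q² = 2^(2k+11).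
  have hpow : (2 : ℝ) ^ (1 - (k : ℤ)) * 2 ^ (k + 2) = 8 := by
    rw [← zpow_natCast, ← zpow_add₀ two_ne_zero,
      show (1 - (k : ℤ)) + ((k + 2 : ℕ) : ℤ) = 3 by push_cast; ring]
    norm_num
  obtain ⟨c, hc, hmax⟩ := Finset.exists_max_image C (lam S) hCne
  refine ⟨c, hc, ?_⟩
  have hQpos : (0 : ℝ) < 2 ^ (k + 2) := by positivity
  suffices h : ((2 : ℝ) ^ (k + 2) - 8) * C.card ≤ 2 ^ (k + 2) * lam S c by
    refine le_of_mul_le_mul_left ?_ hQpos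
    calc (2 : ℝ) ^ (k + 2) * ((1 - (2 : ℝ) ^ (1 - (k : ℤ))) * C.card)
        = ((2 : ℝ) ^ (k + 2) - (2 : ℝ) ^ (1 - (k : ℤ)) * 2 ^ (k + 2)) * C.card := by ring
      _ ≤ _ := by rw [hpow]; exact h
  -- The claimed bound is then nonpositive; k ≥ 2 gives Q ≥ 16.
  by_cases hk : k ≤ 1
  · have h1 : (2 : ℝ) ^ (k + 2) ≤ 2 ^ 3 := pow_le_pow_right₀ one_le_two (by omega)
    have h2 : ((2 : ℝ) ^ (k + 2) - 8) * C.card ≤ 0 :=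
      mul_nonpos_of_nonpos_of_nonneg (by linarith) (Nat.cast_nonneg _)
    exact h2.trans (by positivity)
  have hQ : 16 ≤ 2 ^ (k + 2) := by
    calc 16 = 2 ^ 4 := by norm_num
      _ ≤ 2 ^ (k + 2) := Nat.pow_le_pow_right (by norm_num) (by omega)
  have hCQ : 128 * (2 ^ (k + 2)) ^ 2 ≤ C.card := le_trans (le_of_eq (by ring)) hCk
  rw [le_min_iff, ← Finset.compl_eq_univ_sdiff] at hS
  have hpow' : 2 ^ (k + 2) * C.card = 2 * (2 ^ (k + 1) * C.card) := by ring
  have hcompl := Finset.card_add_card_compl S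
  have key : (2 ^ (k + 2) - 8) * C.card ≤ 2 ^ (k + 2) * lam S c := by
    by_cases h2 : 2 * S.card ≤ Fintype.card G
    · exact sub_mul_card_le_of_forall_lam_le hC hQ hCQ (by omega) h2 hmax
    · refine sub_mul_card_le_of_forall_lam_le (S := Sᶜ) hC hQ hCQ (by omega) (by omega) ?_
      intro x hx
      rw [lam_compl]
      exact hmax x hx
  have key' : (((2 ^ (k + 2) - 8) * C.card : ℕ) : ℝ) ≤ ((2 ^ (k + 2) * lam S c : ℕ) : ℝ) :=
    Nat.cast_le.2 key
  push_cast [Nat.cast_sub (show 8 ≤ 2 ^ (k + 2) by omega)] at key'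
  exact key'

end LowerBound

/-! ### The extremal example (2) in a cyclic group. -/

section Sharpness

theorem subsetSum_Icc (n : ℕ) :
    (Finset.Icc 1 n).subsetSum = Finset.range (∑ i ∈ Finset.Icc 1 n, i + 1) := by
  induction n with
  | zero => rfl
  | succ n ih =>
    have hins : Finset.Icc 1 (n + 1) = insert (n + 1) (Finset.Icc 1 n) := by
      ext; simp only [Finset.mem_Icc, Finset.mem_insert]; omega
    have hnot : n + 1 ∉ Finset.Icc 1 n := by simp
    apply Finset.Subset.antisymm
    · intro t ht
      obtain ⟨B, hB, rfl⟩ := Finset.mem_subsetSum_iff.1 ht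
      rw [Finset.mem_range, Nat.lt_succ_iff]
      exact Finset.sum_le_sum_of_subset hB
    · intro t ht
      rw [Finset.mem_range, hins, Finset.sum_insert hnot] at ht
      set q := ∑ i ∈ Finset.Icc 1 n, i with hq
      have hnq : n ≤ q := by
        obtain rfl | hn := Nat.eq_zero_or_pos n
        · exact Nat.zero_le _
        · exact Finset.single_le_sum (f := fun i => i) (fun _ _ => Nat.zero_le _)
            (Finset.mem_Icc.2 ⟨hn, le_rfl⟩)
      rw [hins]
      by_cases htq : t ≤ q
      · refine Finset.subsetSum_mono (Finset.subset_insert _ _) ?_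
        rw [ih, Finset.mem_range]
        omega
      · have h : t - (n + 1) ∈ (Finset.Icc 1 n).subsetSum := by
          rw [ih, Finset.mem_range]
          omega
        obtain ⟨B, hB, hBt⟩ := Finset.mem_subsetSum_iff.1 h
        refine Finset.mem_subsetSum_iff.2
          ⟨insert (n + 1) B, Finset.insert_subset_insert _ hB, ?_⟩
        rw [Finset.sum_insert fun h => hnot (hB h), hBt]
        omega

theorem ZMod.natCast_inj_of_lt {N a b : ℕ} (ha : a < N) (hb : b < N)
    (h : (a : ZMod N) = b) : a = b := by
  have := congrArg ZMod.val h
  rwa [ZMod.val_cast_of_lt ha, ZMod.val_cast_of_lt hb] at this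

theorem mem_subsetSum_image_Icc {N n : ℕ} (hnN : n < N) {x : ZMod N} :
    x ∈ ((Finset.Icc 1 n).image (Nat.cast : ℕ → ZMod N)).subsetSum ↔
      ∃ t ≤ ∑ i ∈ Finset.Icc 1 n, i, (t : ZMod N) = x := by
  have hsub : ∀ B ⊆ Finset.Icc 1 n,
      ∑ b ∈ B.image (Nat.cast : ℕ → ZMod N), b = ((∑ b ∈ B, b : ℕ) : ZMod N) := by
    intro B hB
    rw [Finset.sum_image, Nat.cast_sum]
    intro a ha b hb hab
    have h1 := Finset.mem_Icc.1 (hB ha)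
    have h2 := Finset.mem_Icc.1 (hB hb)
    exact ZMod.natCast_inj_of_lt (by omega) (by omega) hab
  rw [Finset.mem_subsetSum_iff]
  constructor
  · rintro ⟨B, hB, rfl⟩
    obtain ⟨B', hB', rfl⟩ := Finset.subset_image_iff.1 hB
    refine ⟨∑ b ∈ B', b, ?_, (hsub B' (by exact_mod_cast hB')).symm⟩
    exact Finset.sum_le_sum_of_subset (by exact_mod_cast hB')
  · rintro ⟨t, ht, rfl⟩
    have : t ∈ (Finset.Icc 1 n).subsetSum := by
      rw [subsetSum_Icc, Finset.mem_range]
      omega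
    obtain ⟨B, hB, rfl⟩ := Finset.mem_subsetSum_iff.1 this
    exact ⟨_, Finset.image_subset_image hB, hsub B hB⟩

theorem goodGenerators_image_Icc {N n : ℕ} [NeZero N] (hn : 1 ≤ n) (hN : 2 * n < N)
    (hqN : ∑ i ∈ Finset.Icc 1 n, i + 1 < N) :
    GoodGenerators ((Finset.Icc 1 n).image (Nat.cast : ℕ → ZMod N)) := by
  refine ⟨?_, ?_, ?_⟩
  · rw [eq_top_iff]
    rintro x -
    have h1 : (1 : ZMod N) ∈
        AddSubgroup.closure (((Finset.Icc 1 n).image (Nat.cast : ℕ → ZMod N) : Finset (ZMod N)) :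
          Set (ZMod N)) := by
      refine AddSubgroup.subset_closure (Finset.mem_coe.2 (Finset.mem_image.2 ⟨1, ?_, by simp⟩))
      exact Finset.mem_Icc.2 ⟨le_rfl, hn⟩
    have h2 := AddSubgroup.nsmul_mem _ h1 x.val
    simpa using h2
  · rw [Finset.eq_empty_iff_forall_notMem]
    intro x hx
    rw [Finset.mem_inter, Finset.mem_neg'] at hx
    obtain ⟨a, ha, rfl⟩ := Finset.mem_image.1 hx.1
    obtain ⟨b, hb, hab⟩ := Finset.mem_image.1 hx.2
    rw [Finset.mem_Icc] at ha hb
    have h : ((a + b : ℕ) : ZMod N) = ((0 : ℕ) : ZMod N) := by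
      push_cast
      rw [hab, add_neg_cancel]
    have := ZMod.natCast_inj_of_lt (by omega) (by omega) h
    omega
  · rw [eq_bot_iff]
    intro g hg
    rw [AddAction.mem_stabilizer_iff] at hg
    have hmem : ∀ y : ZMod N, (-g + y) ∈
        ((Finset.Icc 1 n).image (Nat.cast : ℕ → ZMod N)).subsetSum ↔
        y ∈ ((Finset.Icc 1 n).image (Nat.cast : ℕ → ZMod N)).subsetSum := by
      intro y
      rw [← mem_vadd_finset_iff_neg_add_mem, hg]
    have hnN : n < N := by omega
    obtain ⟨v, hv, rfl⟩ := (mem_subsetSum_image_Icc hnN).1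
      ((hmem g).1 (by rw [neg_add_cancel]; exact Finset.zero_mem_subsetSum))
    rw [AddSubgroup.mem_bot]
    by_contra hv0
    have hv1 : v ≠ 0 := by
      rintro rfl
      simp at hv0
    set q := ∑ i ∈ Finset.Icc 1 n, i
    -- A shift by v with 1 ≤ v ≤ q carries q + 1 - v to q + 1, just past the interval of subset
    -- sums.
    obtain ⟨t, ht, htq⟩ := (mem_subsetSum_image_Icc hnN).1
      ((hmem ((q + 1 : ℕ) : ZMod N)).1 ((mem_subsetSum_image_Icc hnN).2
        ⟨q + 1 - v, by omega, by rw [Nat.cast_sub (by omega)]; ring⟩))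
    have := ZMod.natCast_inj_of_lt (by omega) (by omega) htq
    omega

theorem lam_image_range_le {N M c : ℕ} :
    lam ((Finset.range M).image (Nat.cast : ℕ → ZMod N)) (c : ZMod N) ≤ c := by
  have hsub : ((c : ZMod N) +ᵥ (Finset.range M).image (Nat.cast : ℕ → ZMod N)) \
      (Finset.range M).image (Nat.cast : ℕ → ZMod N) ⊆
      (Finset.Ico M (M + c)).image (Nat.cast : ℕ → ZMod N) := by
    intro x hx
    rw [Finset.mem_sdiff, Finset.mem_vadd_finset] at hx
    obtain ⟨⟨y, hy, rfl⟩, hx⟩ := hx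
    obtain ⟨i, hi, rfl⟩ := Finset.mem_image.1 hy
    rw [Finset.mem_range] at hi
    have he : ((c + i : ℕ) : ZMod N) = (c : ZMod N) +ᵥ (i : ZMod N) := by
      rw [vadd_eq_add, Nat.cast_add]
    rw [← he] at hx ⊢
    refine Finset.mem_image_of_mem _ (Finset.mem_Ico.2 ⟨?_, by omega⟩)
    by_contra! h
    exact hx (Finset.mem_image_of_mem _ (Finset.mem_range.2 h))
  calc _ ≤ _ := Finset.card_le_card hsub
    _ ≤ (Finset.Ico M (M + c)).card := Finset.card_image_le
    _ = c := by simp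

theorem exists_goodGenerators_lam_le (n M : ℕ) (hn : 1 ≤ n) :
    ∃ (N : ℕ) (_ : NeZero N) (C S : Finset (ZMod N)),
      GoodGenerators C ∧
      C.card = n ∧
      M ≤ min S.card (Finset.univ \ S).card ∧
      ∀ c ∈ C, lam S c ≤ C.card := by
  obtain ⟨N, hN⟩ : ∃ N, N = 2 * M + 2 * n + ∑ i ∈ Finset.Icc 1 n, i + 2 := ⟨_, rfl⟩
  have : NeZero N := ⟨by omega⟩
  have hcard : ((Finset.Icc 1 n).image (Nat.cast : ℕ → ZMod N)).card = n := by
    rw [Finset.card_image_of_injOn, Nat.card_Icc, Nat.add_sub_cancel]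
    intro a ha b hb hab
    rw [Finset.mem_coe, Finset.mem_Icc] at ha hb
    exact ZMod.natCast_inj_of_lt (by omega) (by omega) hab
  have hScard : ((Finset.range M).image (Nat.cast : ℕ → ZMod N)).card = M := by
    rw [Finset.card_image_of_injOn, Finset.card_range]
    intro a ha b hb hab
    rw [Finset.mem_coe, Finset.mem_range] at ha hb
    exact ZMod.natCast_inj_of_lt (by omega) (by omega) hab
  refine ⟨N, inferInstance, _, (Finset.range M).image (Nat.cast : ℕ → ZMod N),
    goodGenerators_image_Icc hn (by omega) (by omega), hcard, ?_, ?_⟩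
  · have h := Finset.card_add_card_compl ((Finset.range M).image (Nat.cast : ℕ → ZMod N))
    rw [ZMod.card, hScard] at h
    rw [← Finset.compl_eq_univ_sdiff, hScard]
    omega
  · intro c hc
    obtain ⟨i, hi, rfl⟩ := Finset.mem_image.1 hc
    rw [hcard]
    exact lam_image_range_le.trans (Finset.mem_Icc.1 hi).2

end Sharpness

theorem mainTheorem5 :
    (∀ (H : Type*) [AddCommGroup H] [Fintype H] [DecidableEq H] (k : ℕ) (C S : Finset H),
      GoodGenerators C →
      2 ^ (2 * k + 11) ≤ C.card →
      2 ^ (k + 1) * C.card ≤ min S.card (Finset.univ \ S).card →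
      ∃ c ∈ C, (1 - (2 : ℝ) ^ (1 - (k : ℤ))) * (C.card : ℝ) ≤ (lam S c : ℝ)) ∧
    (∀ n M : ℕ, 1 ≤ n →
      ∃ (N : ℕ) (_ : NeZero N) (C S : Finset (ZMod N)),
        GoodGenerators C ∧
        C.card = n ∧
        M ≤ min S.card (Finset.univ \ S).card ∧
        ∀ c ∈ C, lam S c ≤ C.card) := by
  exact ⟨fun H _ _ _ k C S hC hCk hS => exists_lam_ge_of_goodGenerators hC hCk hS,
    exists_goodGenerators_lam_le⟩
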